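/- Let $p,q$ be nonnegative integers. For a positive-definite $n\times n$ matrix $S$, $m\in\mathbb{R}^n$ and $\nu>0$, let $t_n(\cdot;m,S,\nu)$ be the density of the $n$-variate Student $t$ distribution with location $m$, scale matrix $S$ and $\nu$ degrees of freedom, and let $T_n(\cdot;S,\nu)$ be its distribution function when $m=0$. Let $\mu\in\mathbb{R}^p$, $\Sigma\in\mathbb{R}^{p\times p}$ positive definite with positive-definite square root $\Sigma^{1/2}$, $\Lambda\in\mathbb{R}^{p\times q}$, $\tau\in\mathbb{R}^q$, $\nu>0$, and let $\Psi\in\mathbb{R}^{q\times q}$ be a positive-definite correlation matrix. Let $Y$ be a random vector in $\mathbb{R}^p$ with the unified skew-$t$ distribution $SUT_{p,q}(\mu,\Sigma,\Lambda,\tau,\nu,\Psi)$, that is, with density $$ f(y)=t_p(y;\mu,\Sigma,\nu)\,\frac{T_q\big((\tau+\Lambda^\top\Sigma^{-1/2}(y-\mu))\,\nu(y);\Psi,\nu+p\big)}{T_q(\tau;\Psi+\Lambda^\top\Lambda,\nu)},\qquad \nu(y)=\sqrt{\frac{\nu+p}{\nu+(y-\mu)^\top\Sigma^{-1}(y-\mu)}}.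 $$ Let $a,b\in[-\infty,\infty]^p$ with $a_i<b_i$ for all $i$, let $p_1$ be the number of indices $i$ for which $a_i$ and $b_i$ are both finite, and let $k=(k_1,\dots,k_p)$ be a vector of nonnegative integers. Then the moment $\mathbb{E}\big[Y_1^{k_1}\cdots Y_p^{k_p}\mid a\le Y\le b\big]$ of the truncated distribution exists (that is, $\prod_i Y_i^{k_i}$ is integrable under the conditional probability given $a\le Y\le b$) if and only if $$ \sum_{i:\ a_i=-\infty\text{ or }b_i=\infty}k_i<\nu+p_1 . $$ -/

import Mathlib

open MeasureTheory ProbabilityTheory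
open scoped Matrix MatrixOrder

noncomputable section

/-- Squared Mahalanobis distance `δ(y) = (y - μ)ᵀ Σ⁻¹ (y - μ)`. -/
def mahalanobisSq {n : ℕ} (mu : Fin n → ℝ) (Sig : Matrix (Fin n) (Fin n) ℝ)
    (y : Fin n → ℝ) : ℝ :=
  (y - mu) ⬝ᵥ (Sig⁻¹ *ᵥ (y - mu))

/-- Density `t_n(y; μ, Σ, ν)` of the `n`-variate Student `t` distribution with location `μ`,
scale matrix `Σ` and `ν` degrees of freedom. -/
def studentTPdf {n : ℕ} (mu : Fin n → ℝ) (Sig : Matrix (Fin n) (Fin n) ℝ) (nu : ℝ)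
    (y : Fin n → ℝ) : ℝ :=
  Real.Gamma ((nu + n) / 2) /
      (Real.Gamma (nu / 2) * (nu * Real.pi) ^ ((n : ℝ) / 2) * √Sig.det) *
    (1 + mahalanobisSq mu Sig y / nu) ^ (-((nu + n) / 2))

/-- Cumulative distribution function `T_n(x; Σ, ν)` of the `n`-variate Student `t` distribution
with location `0`, scale matrix `Σ` and `ν` degrees of freedom. -/
def studentTCdf {n : ℕ} (Sig : Matrix (Fin n) (Fin n) ℝ) (nu : ℝ) (x : Fin n → ℝ) : ℝ :=
  ∫ z in Set.Iic x, studentTPdf 0 Sig nu z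

/-- Density of the unified skew-`t` distribution `SUT_{p,q}(μ, Σ, Λ, τ, ν, Ψ)`:
`t_p(y; μ, Σ, ν) * T_q((τ + Λᵀ Σ^{-1/2} (y - μ)) ν(y); Ψ, ν + p) / T_q(τ; Ψ + ΛᵀΛ, ν)`,
where `ν(y) = √((ν + p) / (ν + δ(y)))` and `Σ^{1/2}` is the positive square root of `Σ`. -/
def sutPdf {p q : ℕ} (mu : Fin p → ℝ) (Sig : Matrix (Fin p) (Fin p) ℝ)
    (Lam : Matrix (Fin p) (Fin q) ℝ) (tau : Fin q → ℝ) (nu : ℝ)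
    (Psi : Matrix (Fin q) (Fin q) ℝ) (y : Fin p → ℝ) : ℝ :=
  studentTPdf mu Sig nu y *
    studentTCdf Psi (nu + p)
      (√((nu + p) / (nu + mahalanobisSq mu Sig y)) •
        (tau + Lamᵀ *ᵥ ((CFC.sqrt Sig)⁻¹ *ᵥ (y - mu)))) /
    studentTCdf (Psi + Lamᵀ * Lam) nu tau

/-- The unified skew-`t` distribution, as the law on `ℝᵖ` with density `sutPdf`. -/
def sutLaw {p q : ℕ} (mu : Fin p → ℝ) (Sig : Matrix (Fin p) (Fin p) ℝ)
    (Lam : Matrix (Fin p) (Fin q) ℝ) (tau : Fin q → ℝ) (nu : ℝ)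
    (Psi : Matrix (Fin q) (Fin q) ℝ) : Measure (Fin p → ℝ) :=
  volume.withDensity fun y => ENNReal.ofReal (sutPdf mu Sig Lam tau nu Psi y)

/-- The box `{y ∈ ℝᵖ | a ≤ y ≤ b}`, with possibly infinite limits. -/
def truncationBox {p : ℕ} (a b : Fin p → EReal) : Set (Fin p → ℝ) :=
  {y | ∀ i, a i ≤ (y i : EReal) ∧ (y i : EReal) ≤ b i}

/-- The coordinates with both truncation limits finite. -/
def finiteCoords {p : ℕ} (a b : Fin p → EReal) : Finset (Fin p) :=
  {i | (a i ≠ ⊥ ∧ a i ≠ ⊤) ∧ (b i ≠ ⊥ ∧ b i ≠ ⊤)}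

end

/-! Skewing does not change the tail. The argument of `T_q` is an affine function of `y` times a
factor of order `1/(1 + ‖y‖)`, so it stays bounded and `T_q` stays between two positive constants.
Hence the density is comparable to `(1 + ‖y‖) ^ (-s)` with `s = ν + p` (`sutPdf_two_sided`), and
only integrability of the monomial against this weight on the box matters. Let `m = p - p₁` count
the unbounded coordinates and `K` be the sum of their `k i`. At scale `X` the region has volume of
order `X ^ m` and the integrand is of order `X ^ (K - s)`, so the threshold is `K + m < s`, that is
`K < ν + p₁`. Necessity sums over disjoint dyadic boxes (`sum_add_card_lt_of_integrableOn`);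
sufficiency uses a product of one-variable majorants (`integrableOn_of_sum_add_card_lt`). -/

/-! ### Two-sided bounds for the Student density -/

theorem quadForm_two_sided {n : ℕ} {A : Matrix (Fin n) (Fin n) ℝ} (hA : A.PosDef) :
    ∃ c C : ℝ, 0 < c ∧ 0 < C ∧ ∀ v : Fin n → ℝ,
      c * ‖v‖ ^ 2 ≤ v ⬝ᵥ (A *ᵥ v) ∧ v ⬝ᵥ (A *ᵥ v) ≤ C * ‖v‖ ^ 2 := by
  have hcont : Continuous fun v : Fin n → ℝ => v ⬝ᵥ (A *ᵥ v) := by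
    unfold dotProduct Matrix.mulVec dotProduct
    fun_prop
  have hpos : ∀ v : Fin n → ℝ, v ≠ 0 → 0 < v ⬝ᵥ (A *ᵥ v) := fun v hv => by
    simpa using hA.dotProduct_mulVec_pos hv
  have hcomp : IsCompact (Metric.sphere (0 : Fin n → ℝ) 1) := isCompact_sphere 0 1
  have key : ∃ c C : ℝ, 0 < c ∧ 0 < C ∧ ∀ v ∈ Metric.sphere (0 : Fin n → ℝ) 1,
      c ≤ v ⬝ᵥ (A *ᵥ v) ∧ v ⬝ᵥ (A *ᵥ v) ≤ C := by
    -- The unit sphere is empty when `n = 0`.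
    rcases (Metric.sphere (0 : Fin n → ℝ) 1).eq_empty_or_nonempty with he | hne
    · exact ⟨1, 1, one_pos, one_pos, by simp [he]⟩
    · obtain ⟨x, hx, hxm⟩ := hcomp.exists_isMinOn hne hcont.continuousOn
      obtain ⟨z, hz, hzm⟩ := hcomp.exists_isMaxOn hne hcont.continuousOn
      have hx0 : x ≠ 0 := by rintro rfl; simp at hx
      have hz0 : z ≠ 0 := by rintro rfl; simp at hz
      exact ⟨_, _, hpos x hx0, hpos z hz0, fun v hv => ⟨hxm hv, hzm hv⟩⟩
  obtain ⟨c, C, hc, hC, h⟩ := key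
  refine ⟨c, C, hc, hC, fun v => ?_⟩
  by_cases hv : v = 0
  · simp [hv]
  have hn : 0 < ‖v‖ := norm_pos_iff.2 hv
  have hs := h (‖v‖⁻¹ • v) (by simp [norm_smul, hn.ne'])
  have he : (‖v‖⁻¹ • v) ⬝ᵥ (A *ᵥ (‖v‖⁻¹ • v)) = (v ⬝ᵥ (A *ᵥ v)) / ‖v‖ ^ 2 := by
    rw [Matrix.mulVec_smul, smul_dotProduct, dotProduct_smul, smul_eq_mul, smul_eq_mul]
    field_simp
  rw [he, le_div_iff₀ (by positivity), div_le_iff₀ (by positivity)] at hs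
  exact hs

theorem continuous_mahalanobisSq {n : ℕ} (mu : Fin n → ℝ) (Sig : Matrix (Fin n) (Fin n) ℝ) :
    Continuous (mahalanobisSq mu Sig) := by
  unfold mahalanobisSq Matrix.mulVec dotProduct
  fun_prop

theorem one_add_mahalanobisSq_two_sided {n : ℕ} (mu : Fin n → ℝ)
    {Sig : Matrix (Fin n) (Fin n) ℝ} (hSig : Sig.PosDef) {nu : ℝ} (hnu : 0 < nu) :
    ∃ c C : ℝ, 0 < c ∧ 0 < C ∧ ∀ y : Fin n → ℝ,
      c * (1 + ‖y‖) ^ 2 ≤ 1 + mahalanobisSq mu Sig y / nu ∧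
        1 + mahalanobisSq mu Sig y / nu ≤ C * (1 + ‖y‖) ^ 2 := by
  obtain ⟨c, C, hc, hC, h⟩ := quadForm_two_sided hSig.inv
  set d := min 1 (c / nu) with hd
  have hd0 : 0 < d := lt_min one_pos (by positivity)
  -- Recentring from `mu` to `0` costs a factor `1 + ‖mu‖`; the 2 comes from `(1 + t)² ≤ 2 (1 +
  -- t²)`.
  refine ⟨d / (2 * (1 + ‖mu‖) ^ 2), (1 + C / nu) * (1 + ‖mu‖) ^ 2, by positivity, by positivity,
    fun y => ?_⟩
  obtain ⟨h1, h2⟩ := h (y - mu)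
  have hm : mahalanobisSq mu Sig y = (y - mu) ⬝ᵥ (Sig⁻¹ *ᵥ (y - mu)) := rfl
  rw [← hm] at h1 h2
  have t1 : ‖y‖ ≤ ‖y - mu‖ + ‖mu‖ := by simpa using norm_add_le (y - mu) mu
  have t2 : ‖y - mu‖ ≤ ‖y‖ + ‖mu‖ := norm_sub_le y mu
  have n1 := norm_nonneg y
  have n2 := norm_nonneg mu
  have n3 := norm_nonneg (y - mu)
  have b1 : 1 + ‖y‖ ≤ (1 + ‖mu‖) * (1 + ‖y - mu‖) := by nlinarith
  have b2 : 1 + ‖y - mu‖ ≤ (1 + ‖mu‖) * (1 + ‖y‖) := by nlinarith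
  have g1 : c / nu * ‖y - mu‖ ^ 2 ≤ mahalanobisSq mu Sig y / nu := by
    rw [div_mul_eq_mul_div]; gcongr
  have g2 : mahalanobisSq mu Sig y / nu ≤ C / nu * ‖y - mu‖ ^ 2 := by
    rw [div_mul_eq_mul_div]; gcongr
  constructor
  · rw [div_mul_eq_mul_div, div_le_iff₀ (by positivity)]
    calc d * (1 + ‖y‖) ^ 2 ≤ d * ((1 + ‖mu‖) * (1 + ‖y - mu‖)) ^ 2 := by gcongr
      _ ≤ d * (2 * (1 + ‖mu‖) ^ 2 * (1 + ‖y - mu‖ ^ 2)) := by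
        gcongr
        rw [mul_pow]
        nlinarith [mul_nonneg (sq_nonneg (1 + ‖mu‖)) (sq_nonneg (1 - ‖y - mu‖))]
      _ = (d * 1 + d * ‖y - mu‖ ^ 2) * (2 * (1 + ‖mu‖) ^ 2) := by ring
      _ ≤ (1 + c / nu * ‖y - mu‖ ^ 2) * (2 * (1 + ‖mu‖) ^ 2) := by
        gcongr
        · rw [mul_one]
          exact min_le_left 1 (c / nu)
        · exact min_le_right 1 (c / nu)
      _ ≤ _ := by gcongr
  · have hq : 0 < C / nu := by positivity
    calc 1 + mahalanobisSq mu Sig y / nu ≤ 1 + C / nu * ‖y - mu‖ ^ 2 := by gcongr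
      _ ≤ (1 + C / nu) * (1 + ‖y - mu‖) ^ 2 := by nlinarith [mul_nonneg hq.le n3]
      _ ≤ (1 + C / nu) * ((1 + ‖mu‖) * (1 + ‖y‖)) ^ 2 := by gcongr
      _ = _ := by ring

theorem studentTPdf_two_sided {n : ℕ} (mu : Fin n → ℝ)
    {Sig : Matrix (Fin n) (Fin n) ℝ} (hSig : Sig.PosDef) {nu : ℝ} (hnu : 0 < nu) :
    ∃ c C : ℝ, 0 < c ∧ 0 < C ∧ ∀ y : Fin n → ℝ,
      c * (1 + ‖y‖) ^ (-(nu + n)) ≤ studentTPdf mu Sig nu y ∧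
        studentTPdf mu Sig nu y ≤ C * (1 + ‖y‖) ^ (-(nu + n)) := by
  obtain ⟨c, C, hc, hC, h⟩ := one_add_mahalanobisSq_two_sided mu hSig hnu
  have hdet := hSig.det_pos
  have hG1 : 0 < Real.Gamma ((nu + n) / 2) := Real.Gamma_pos_of_pos (by positivity)
  have hG2 : 0 < Real.Gamma (nu / 2) := Real.Gamma_pos_of_pos (by positivity)
  have hK : 0 < Real.Gamma ((nu + n) / 2) /
      (Real.Gamma (nu / 2) * (nu * Real.pi) ^ ((n : ℝ) / 2) * √Sig.det) := by
    have := Real.pi_pos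
    positivity
  set κ := Real.Gamma ((nu + n) / 2) /
      (Real.Gamma (nu / 2) * (nu * Real.pi) ^ ((n : ℝ) / 2) * √Sig.det) with hκ
  have hpow : ∀ (d : ℝ), 0 < d → ∀ y : Fin n → ℝ, (d * (1 + ‖y‖) ^ 2) ^ (-((nu + n) / 2)) =
      d ^ (-((nu + n) / 2)) * (1 + ‖y‖) ^ (-(nu + n)) := fun d hd y => by
    rw [Real.mul_rpow hd.le (by positivity), ← Real.rpow_natCast, ← Real.rpow_mul (by positivity)]
    congr 2
    push_cast
    ring
  refine ⟨κ * C ^ (-((nu + n) / 2)), κ * c ^ (-((nu + n) / 2)), by positivity, by positivity,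
    fun y => ?_⟩
  have hneg : -((nu + n) / 2) ≤ 0 := by
    have : 0 ≤ (nu + n) / 2 := by positivity
    linarith
  obtain ⟨h1, h2⟩ := h y
  have h0 : 0 < c * (1 + ‖y‖) ^ 2 := by positivity
  unfold studentTPdf
  rw [← hκ]
  rw [mul_assoc, mul_assoc, ← hpow C hC, ← hpow c hc]
  exact ⟨mul_le_mul_of_nonneg_left
      (Real.rpow_le_rpow_of_nonpos (h0.trans_le h1) h2 hneg) hK.le,
    mul_le_mul_of_nonneg_left (Real.rpow_le_rpow_of_nonpos h0 h1 hneg) hK.le⟩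

theorem studentTPdf_pos {n : ℕ} (mu : Fin n → ℝ)
    {Sig : Matrix (Fin n) (Fin n) ℝ} (hSig : Sig.PosDef) {nu : ℝ} (hnu : 0 < nu)
    (y : Fin n → ℝ) : 0 < studentTPdf mu Sig nu y := by
  obtain ⟨c, C, hc, hC, h⟩ := studentTPdf_two_sided mu hSig hnu
  exact lt_of_lt_of_le (by positivity) (h y).1

theorem measurable_studentTPdf {n : ℕ} (mu : Fin n → ℝ) (Sig : Matrix (Fin n) (Fin n) ℝ)
    (nu : ℝ) : Measurable (studentTPdf mu Sig nu) := by
  have := (continuous_mahalanobisSq mu Sig).measurable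
  unfold studentTPdf
  fun_prop

theorem integrable_studentTPdf {n : ℕ} (mu : Fin n → ℝ)
    {Sig : Matrix (Fin n) (Fin n) ℝ} (hSig : Sig.PosDef) {nu : ℝ} (hnu : 0 < nu) :
    Integrable (studentTPdf mu Sig nu) := by
  obtain ⟨c, C, hc, hC, h⟩ := studentTPdf_two_sided mu hSig hnu
  have hi : Integrable fun y : Fin n → ℝ => C * (1 + ‖y‖) ^ (-(nu + n)) :=
    (integrable_one_add_norm (by simpa using hnu)).const_mul C
  refine hi.mono' (measurable_studentTPdf mu Sig nu).aestronglyMeasurable (.of_forall fun y => ?_)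
  rw [Real.norm_of_nonneg (studentTPdf_pos mu hSig hnu y).le]
  exact (h y).2

/-! ### Student distribution function and the skewed density -/

theorem studentTCdf_mono {n : ℕ} {Sig : Matrix (Fin n) (Fin n) ℝ} (hSig : Sig.PosDef)
    {nu : ℝ} (hnu : 0 < nu) : Monotone (studentTCdf Sig nu) := fun _ _ hxy =>
  setIntegral_mono_set (integrable_studentTPdf 0 hSig hnu).integrableOn
    (.of_forall fun y => (studentTPdf_pos 0 hSig hnu y).le)
    (Set.Iic_subset_Iic.2 hxy).eventuallyLE

theorem studentTCdf_le {n : ℕ} {Sig : Matrix (Fin n) (Fin n) ℝ} (hSig : Sig.PosDef)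
    {nu : ℝ} (hnu : 0 < nu) (x : Fin n → ℝ) :
    studentTCdf Sig nu x ≤ ∫ z, studentTPdf 0 Sig nu z :=
  setIntegral_le_integral (integrable_studentTPdf 0 hSig hnu)
    (.of_forall fun y => (studentTPdf_pos 0 hSig hnu y).le)

theorem studentTCdf_pos {n : ℕ} {Sig : Matrix (Fin n) (Fin n) ℝ} (hSig : Sig.PosDef)
    {nu : ℝ} (hnu : 0 < nu) (x : Fin n → ℝ) : 0 < studentTCdf Sig nu x := by
  unfold studentTCdf
  rw [setIntegral_pos_iff_support_of_nonneg_ae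
    (.of_forall fun y => (studentTPdf_pos 0 hSig hnu y).le)
    (integrable_studentTPdf 0 hSig hnu).integrableOn]
  have hs : Function.support (studentTPdf 0 Sig nu) = Set.univ :=
    Set.eq_univ_of_forall fun y => (studentTPdf_pos 0 hSig hnu y).ne'
  rw [hs, Set.univ_inter, ← Set.pi_univ_Iic, volume_pi_pi]
  exact pos_iff_ne_zero.2 (Finset.prod_ne_zero_iff.2 fun i _ => by simp)

theorem measurable_studentTCdf {n : ℕ} (Sig : Matrix (Fin n) (Fin n) ℝ) (nu : ℝ) :
    Measurable (studentTCdf Sig nu) := by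
  have hs : MeasurableSet {w : (Fin n → ℝ) × (Fin n → ℝ) | w.2 ≤ w.1} :=
    measurableSet_le measurable_snd measurable_fst
  have hf : StronglyMeasurable (Function.uncurry fun x z : Fin n → ℝ =>
      (Set.Iic x).indicator (studentTPdf 0 Sig nu) z) :=
    (((measurable_studentTPdf 0 Sig nu).comp measurable_snd).indicator hs).stronglyMeasurable
  have he : studentTCdf Sig nu = fun x => ∫ z, (Set.Iic x).indicator (studentTPdf 0 Sig nu) z :=
    funext fun x => (integral_indicator measurableSet_Iic).symm
  rw [he]
  exact hf.integral_prod_right.measurable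

theorem measurable_sutPdf {p q : ℕ} (mu : Fin p → ℝ) (Sig : Matrix (Fin p) (Fin p) ℝ)
    (Lam : Matrix (Fin p) (Fin q) ℝ) (tau : Fin q → ℝ) (nu : ℝ)
    (Psi : Matrix (Fin q) (Fin q) ℝ) : Measurable (sutPdf mu Sig Lam tau nu Psi) := by
  have h1 := measurable_studentTPdf mu Sig nu
  have h2 := (continuous_mahalanobisSq mu Sig).measurable
  have h3 : Measurable fun y : Fin p → ℝ => tau + Lamᵀ *ᵥ ((CFC.sqrt Sig)⁻¹ *ᵥ (y - mu)) := by
    refine Continuous.measurable ?_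
    unfold Matrix.mulVec dotProduct
    fun_prop
  have h4 : Measurable fun y : Fin p → ℝ => √((nu + p) / (nu + mahalanobisSq mu Sig y)) := by
    fun_prop
  exact (h1.mul ((measurable_studentTCdf Psi (nu + p)).comp (h4.smul h3))).div_const _

/-- Since the argument of `T_q` has sup norm at most some `M`, monotonicity bounds `T_q` below by
its value at `(-M, …, -M)`, which is positive, and the total mass bounds it above. -/
theorem sutPdf_two_sided {p q : ℕ} (mu : Fin p → ℝ) {Sig : Matrix (Fin p) (Fin p) ℝ}
    (hSig : Sig.PosDef) (Lam : Matrix (Fin p) (Fin q) ℝ) (tau : Fin q → ℝ) {nu : ℝ}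
    (hnu : 0 < nu) {Psi : Matrix (Fin q) (Fin q) ℝ} (hPsi : Psi.PosDef) :
    ∃ c C : ℝ, 0 < c ∧ 0 < C ∧ ∀ y : Fin p → ℝ,
      c * (1 + ‖y‖) ^ (-(nu + p)) ≤ sutPdf mu Sig Lam tau nu Psi y ∧
        sutPdf mu Sig Lam tau nu Psi y ≤ C * (1 + ‖y‖) ^ (-(nu + p)) := by
  obtain ⟨c, C, hc, hC, h⟩ := studentTPdf_two_sided mu hSig hnu
  obtain ⟨d, _, hd, _, hm⟩ := one_add_mahalanobisSq_two_sided mu hSig hnu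
  have hnup : 0 < nu + p := by positivity
  have hden : 0 < studentTCdf (Psi + Lamᵀ * Lam) nu tau := by
    refine studentTCdf_pos (hPsi.add_posSemidef ?_) hnu tau
    simpa using Matrix.posSemidef_conjTranspose_mul_self Lam
  obtain ⟨M, hM⟩ : ∃ M : ℝ, ∀ y : Fin p → ℝ,
      ‖√((nu + p) / (nu + mahalanobisSq mu Sig y)) •
        (tau + Lamᵀ *ᵥ ((CFC.sqrt Sig)⁻¹ *ᵥ (y - mu)))‖ ≤ M := by
    let L : (Fin p → ℝ) →L[ℝ] (Fin q → ℝ) :=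
      (Matrix.mulVecLin (Lamᵀ * (CFC.sqrt Sig)⁻¹)).toContinuousLinearMap
    have hL : ∀ v, Lamᵀ *ᵥ ((CFC.sqrt Sig)⁻¹ *ᵥ v) = L v := fun v => by
      rw [Matrix.mulVec_mulVec]
      rfl
    refine ⟨√((nu + p) / (nu * d)) * (‖tau‖ + ‖L‖ * (1 + ‖mu‖)), fun y => ?_⟩
    have hy : 0 < 1 + ‖y‖ := by positivity
    have e1 : nu * d * (1 + ‖y‖) ^ 2 ≤ nu + mahalanobisSq mu Sig y := by
      have := mul_le_mul_of_nonneg_left (hm y).1 hnu.le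
      rw [mul_add, mul_div_cancel₀ _ hnu.ne'] at this
      linarith
    have e2 : √((nu + p) / (nu + mahalanobisSq mu Sig y)) ≤
        √((nu + p) / (nu * d)) / (1 + ‖y‖) := by
      have e0 : √((nu + p) / (nu * d)) / (1 + ‖y‖) =
          √((nu + p) / (nu * d * (1 + ‖y‖) ^ 2)) := by
        rw [← div_div _ (nu * d), Real.sqrt_div' _ (sq_nonneg _), Real.sqrt_sq hy.le]
      rw [e0]
      exact Real.sqrt_le_sqrt (by gcongr)
    have e3 : ‖tau + L (y - mu)‖ ≤ (‖tau‖ + ‖L‖ * (1 + ‖mu‖)) * (1 + ‖y‖) := by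
      calc ‖tau + L (y - mu)‖ ≤ ‖tau‖ + ‖L‖ * (‖y‖ + ‖mu‖) :=
            (norm_add_le _ _).trans (by
              gcongr
              exact (L.le_opNorm _).trans (by gcongr; exact norm_sub_le _ _))
        _ ≤ _ := by
            have n1 := norm_nonneg y
            have n2 := norm_nonneg mu
            have n3 : 0 ≤ ‖L‖ := norm_nonneg L
            have n4 := norm_nonneg tau
            have : ‖y‖ + ‖mu‖ ≤ (1 + ‖mu‖) * (1 + ‖y‖) := by nlinarith
            nlinarith [mul_le_mul_of_nonneg_left this n3, mul_nonneg n4 n1]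
    rw [norm_smul, Real.norm_of_nonneg (Real.sqrt_nonneg _), hL]
    calc _ ≤ √((nu + p) / (nu * d)) / (1 + ‖y‖) *
          ((‖tau‖ + ‖L‖ * (1 + ‖mu‖)) * (1 + ‖y‖)) := by gcongr
      _ = _ := by field_simp
  set D := studentTCdf (Psi + Lamᵀ * Lam) nu tau
  set lo := studentTCdf Psi (nu + p) fun _ => -M
  set hi := ∫ z, studentTPdf 0 Psi (nu + p) z
  have hlo : 0 < lo := studentTCdf_pos hPsi hnup _
  have hhi : 0 < hi := hlo.trans_le (studentTCdf_le hPsi hnup _)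
  refine ⟨c * lo / D, C * hi / D, by positivity, by positivity, fun y => ?_⟩
  have hpdf := studentTPdf_pos mu hSig hnu y
  have hw : 0 < (1 + ‖y‖) ^ (-(nu + p)) := by positivity
  have k1 := studentTCdf_mono hPsi hnup (a := fun _ => -M)
    (b := √((nu + p) / (nu + mahalanobisSq mu Sig y)) •
        (tau + Lamᵀ *ᵥ ((CFC.sqrt Sig)⁻¹ *ᵥ (y - mu))))
    (fun j => neg_le_of_abs_le ((norm_le_pi_norm _ j).trans (hM y)))
  have k2 := studentTCdf_le hPsi hnup (√((nu + p) / (nu + mahalanobisSq mu Sig y)) •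
        (tau + Lamᵀ *ᵥ ((CFC.sqrt Sig)⁻¹ *ᵥ (y - mu))))
  unfold sutPdf
  constructor
  · rw [div_mul_eq_mul_div, mul_right_comm]
    gcongr
    exact (h y).1
  · rw [div_mul_eq_mul_div, mul_right_comm]
    gcongr
    · exact (hlo.trans_le k1).le
    · exact (h y).2

/-! ### The truncation box and its dyadic pieces -/

theorem mem_finiteCoords {p : ℕ} {a b : Fin p → EReal} {i : Fin p} :
    i ∈ finiteCoords a b ↔ (a i ≠ ⊥ ∧ a i ≠ ⊤) ∧ (b i ≠ ⊥ ∧ b i ≠ ⊤) := by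
  simp [finiteCoords]

/-- Staying away from zero keeps the factors `|y i| ^ k i` of the bounded coordinates from spoiling
a lower bound. -/
theorem exists_Icc_subset_avoiding_zero {a b : ℝ} (hab : a < b) :
    ∃ α β c C : ℝ, α < β ∧ 0 < c ∧ 0 < C ∧
      ∀ t ∈ Set.Icc α β, (a ≤ t ∧ t ≤ b) ∧ c ≤ |t| ∧ |t| ≤ C := by
  rcases lt_or_ge 0 b with hb | hb
  · refine ⟨max ((a + b) / 2) (b / 2), b, b / 2, b, max_lt (by linarith) (by linarith),
      by linarith, hb, fun t ⟨h1, h2⟩ => ?_⟩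
    have h3 := (le_max_left ((a + b) / 2) (b / 2)).trans h1
    have h4 := (le_max_right ((a + b) / 2) (b / 2)).trans h1
    rw [abs_of_nonneg (by linarith)]
    exact ⟨⟨by linarith, h2⟩, h4, h2⟩
  · have ha : a < 0 := hab.trans_le hb
    refine ⟨a, min ((a + b) / 2) (a / 2), -a / 2, -a, lt_min (by linarith) (by linarith),
      by linarith, by linarith, fun t ⟨h1, h2⟩ => ?_⟩
    have h3 := h2.trans (min_le_left ((a + b) / 2) (a / 2))
    have h4 := h2.trans (min_le_right ((a + b) / 2) (a / 2))
    rw [abs_of_nonpos (by linarith)]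
    exact ⟨⟨h1, by linarith⟩, by linarith, by linarith⟩

theorem exists_dyadic_intervals_of_infinite {a b : EReal} (hab : a < b) (h : a = ⊥ ∨ b = ⊤) :
    ∃ (J : ℕ → Set ℝ) (N : ℕ), ∀ n, N ≤ n → MeasurableSet (J n) ∧
      volume (J n) = ENNReal.ofReal (2 ^ n) ∧ ∀ t ∈ J n, (a ≤ (t : EReal) ∧ (t : EReal) ≤ b) ∧
        2 ^ n ≤ |t| ∧ |t| < 2 ^ (n + 1) := by
  have hlen : ∀ n : ℕ, (2 : ℝ) ^ (n + 1) - 2 ^ n = 2 ^ n := fun n => by ring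
  rcases h with rfl | rfl
  · obtain ⟨r, -, hr⟩ := EReal.lt_iff_exists_real_btwn.1 hab
    obtain ⟨N, hN⟩ := pow_unbounded_of_one_lt (-r) (one_lt_two (α := ℝ))
    refine ⟨fun n => Set.Ioc (-2 ^ (n + 1)) (-2 ^ n), N, fun n hn => ⟨measurableSet_Ioc, ?_,
      fun t ⟨h1, h2⟩ => ?_⟩⟩
    · rw [Real.volume_Ioc]
      congr 1
      ring
    · have h3 : (2 : ℝ) ^ N ≤ 2 ^ n := pow_le_pow_right₀ one_le_two hn
      have h4 : (0 : ℝ) < 2 ^ n := by positivity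
      rw [abs_of_neg (by linarith)]
      refine ⟨⟨bot_le, le_trans ?_ hr.le⟩, by linarith, by linarith⟩
      exact_mod_cast (by linarith : t ≤ r)
  · obtain ⟨r, hr, -⟩ := EReal.lt_iff_exists_real_btwn.1 hab
    obtain ⟨N, hN⟩ := pow_unbounded_of_one_lt r (one_lt_two (α := ℝ))
    refine ⟨fun n => Set.Ico (2 ^ n) (2 ^ (n + 1)), N, fun n hn => ⟨measurableSet_Ico, ?_,
      fun t ⟨h1, h2⟩ => ?_⟩⟩
    · rw [Real.volume_Ico, hlen]
    · have h3 : (2 : ℝ) ^ N ≤ 2 ^ n := pow_le_pow_right₀ one_le_two hn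
      have h4 : (0 : ℝ) < 2 ^ n := by positivity
      rw [abs_of_pos (by linarith)]
      refine ⟨⟨hr.le.trans ?_, le_top⟩, h1, h2⟩
      exact_mod_cast (by linarith : r ≤ t)

theorem eq_bot_or_eq_top_of_notMem_finiteCoords {p : ℕ} {a b : Fin p → EReal}
    (hab : ∀ i, a i < b i) {i : Fin p} (hi : i ∉ finiteCoords a b) : a i = ⊥ ∨ b i = ⊤ := by
  by_contra! h
  exact hi (mem_finiteCoords.2 ⟨⟨h.1, (hab i).ne_top⟩, (hab i).ne_bot, h.2⟩)

/-- Treats both kinds of coordinate uniformly: the scale is `1` if bounded and `2 ^ n` if not. The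
last clause makes different scales disjoint. -/
theorem exists_dyadic_intervals {p : ℕ} {a b : Fin p → EReal} (hab : ∀ i, a i < b i) (i : Fin p) :
    ∃ (J : ℕ → Set ℝ) (N : ℕ) (c C v : ℝ), 0 < c ∧ 0 < C ∧ 0 < v ∧ ∀ n, N ≤ n →
      MeasurableSet (J n) ∧
      volume (J n) = ENNReal.ofReal (v * if i ∈ finiteCoords a b then 1 else 2 ^ n) ∧
      ∀ t ∈ J n, (a i ≤ (t : EReal) ∧ (t : EReal) ≤ b i) ∧
        (c * (if i ∈ finiteCoords a b then 1 else 2 ^ n) ≤ |t| ∧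
          |t| ≤ C * if i ∈ finiteCoords a b then 1 else 2 ^ n) ∧
        (i ∉ finiteCoords a b → 2 ^ n ≤ |t| ∧ |t| < 2 ^ (n + 1)) := by
  by_cases hi : i ∈ finiteCoords a b
  · obtain ⟨⟨h1, h2⟩, h3, h4⟩ := mem_finiteCoords.1 hi
    have ha := EReal.coe_toReal h2 h1
    have hb := EReal.coe_toReal h4 h3
    have hlt := hab i
    rw [← ha, ← hb, EReal.coe_lt_coe_iff] at hlt
    obtain ⟨α, β, c, C, hαβ, hc, hC, h⟩ := exists_Icc_subset_avoiding_zero hlt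
    refine ⟨fun _ => Set.Icc α β, 0, c, C, β - α, hc, hC, sub_pos.2 hαβ, fun n _ =>
      ⟨measurableSet_Icc, by simp [hi], fun t ht => ⟨?_, by simpa [hi] using (h t ht).2,
        fun h => absurd hi h⟩⟩⟩
    rw [← ha, ← hb]
    exact_mod_cast (h t ht).1
  · obtain ⟨J, N, h⟩ := exists_dyadic_intervals_of_infinite (hab i)
      (eq_bot_or_eq_top_of_notMem_finiteCoords hab hi)
    refine ⟨J, N, 1, 2, 1, one_pos, two_pos, one_pos, fun n hn => ?_⟩
    obtain ⟨h1, h2, h3⟩ := h n hn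
    refine ⟨h1, by simpa [hi] using h2, fun t ht => ⟨(h3 t ht).1, ?_, fun _ => (h3 t ht).2⟩⟩
    obtain ⟨-, h4, h5⟩ := h3 t ht
    rw [pow_succ] at h5
    simp only [hi, if_false]
    exact ⟨by linarith, by linarith⟩

theorem measurableSet_truncationBox {p : ℕ} (a b : Fin p → EReal) :
    MeasurableSet (truncationBox a b) := by
  unfold truncationBox
  simp only [Set.ofPred_forall]
  refine MeasurableSet.iInter fun i => ?_
  have h : Measurable fun y : Fin p → ℝ => (y i : EReal) :=
    measurable_coe_real_ereal.comp (measurable_pi_apply i)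
  exact (measurableSet_le measurable_const h).inter (measurableSet_le h measurable_const)

theorem prod_ite_one_pow {ι : Type*} [Fintype ι] [DecidableEq ι] (F : Finset ι) (X : ℝ)
    (e : ι → ℕ) : ∏ i, (if i ∈ F then 1 else X) ^ e i = X ^ ∑ i ∈ Fᶜ, e i := by
  rw [← Finset.prod_pow_eq_pow_sum, ← Finset.prod_mul_prod_compl F,
    Finset.prod_eq_one (fun i hi => by simp [hi]), one_mul]
  exact Finset.prod_congr rfl fun i hi => by simp [Finset.mem_compl.1 hi]

theorem volume_truncationBox_pos {p : ℕ} {a b : Fin p → EReal} (hab : ∀ i, a i < b i) :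
    0 < volume (truncationBox a b) := by
  choose J N c C v _ _ hv h using exists_dyadic_intervals hab
  have hsub : Set.univ.pi (fun i => J i (N i)) ⊆ truncationBox a b := fun y hy i =>
    ((h i (N i) le_rfl).2.2 (y i) (hy i trivial)).1
  refine lt_of_lt_of_le ?_ (measure_mono hsub)
  rw [volume_pi_pi]
  refine pos_iff_ne_zero.2 (Finset.prod_ne_zero_iff.2 fun i _ => ?_)
  rw [(h i (N i) le_rfl).2.1]
  refine (ENNReal.ofReal_pos.2 (mul_pos (hv i) ?_)).ne'
  split_ifs <;> positivity

/-! ### Integrability of monomials against a power weight -/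

theorem sum_add_card_lt_of_integrableOn {p : ℕ} {a b : Fin p → EReal} (hab : ∀ i, a i < b i)
    (k : Fin p → ℕ) {s : ℝ} (hs : ((finiteCoords a b)ᶜ.card : ℝ) < s)
    (hint : IntegrableOn (fun y : Fin p → ℝ => (∏ i, y i ^ k i) * (1 + ‖y‖) ^ (-s))
      (truncationBox a b)) :
    ((∑ i ∈ (finiteCoords a b)ᶜ, k i : ℕ) : ℝ) + (finiteCoords a b)ᶜ.card < s := by
  by_contra! hK
  set F := finiteCoords a b with hF
  set K := ∑ i ∈ Fᶜ, k i with hKdef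
  -- Without unbounded coordinates `hs` reads `0 < s` and `hK` reads `s ≤ 0`.
  obtain ⟨i₀, hi₀⟩ : ∃ i, i ∉ F := by
    by_contra! hall
    have : Fᶜ = ∅ := by simpa [Finset.eq_univ_iff_forall] using hall
    simp only [this, Finset.sum_empty, Finset.card_empty] at hK hs hKdef
    rw [hKdef] at hK
    norm_num at hK hs
    linarith
  choose J N c C v hc hC hv h using exists_dyadic_intervals hab
  -- A common shift after which every coordinate's dyadic interval is available.
  set M := Finset.univ.sup N
  set D : ℕ → Set (Fin p → ℝ) := fun n => Set.univ.pi fun i => J i (n + M) with hD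
  have hM : ∀ i n, N i ≤ n + M := fun i n =>
    (Finset.le_sup (f := N) (Finset.mem_univ i)).trans (Nat.le_add_left _ _)
  have hDm : ∀ n, MeasurableSet (D n) := fun n =>
    MeasurableSet.univ_pi fun i => (h i _ (hM i n)).1
  have hDsub : ∀ n, D n ⊆ truncationBox a b := fun n y hy i =>
    ((h i _ (hM i n)).2.2 (y i) (hy i trivial)).1
  have hDdisj : Pairwise (Function.onFun Disjoint D) := by
    have key : ∀ m n, m < n → Disjoint (D m) (D n) := fun m n hmn => by
      refine Set.disjoint_left.2 fun y hm hn => ?_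
      have h1 := (((h i₀ _ (hM i₀ m)).2.2 (y i₀) (hm i₀ trivial)).2.2 hi₀).2
      have h2 := (((h i₀ _ (hM i₀ n)).2.2 (y i₀) (hn i₀ trivial)).2.2 hi₀).1
      have h3 : (2 : ℝ) ^ (m + M + 1) ≤ 2 ^ (n + M) :=
        pow_le_pow_right₀ one_le_two (by omega)
      linarith
    intro m n hmn
    rcases hmn.lt_or_gt with hlt | hlt
    · exact key m n hlt
    · exact (key n m hlt).symm
  have hint' : IntegrableOn (fun y : Fin p → ℝ => ‖(∏ i, y i ^ k i) * (1 + ‖y‖) ^ (-s)‖)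
      (truncationBox a b) := hint.norm
  have hsum := (hasSum_integral_iUnion hDm hDdisj
    (hint'.mono_set (Set.iUnion_subset hDsub))).summable.tendsto_atTop_zero
  set C₀ := ∑ i, C i
  have hC₀ : 0 ≤ C₀ := Finset.sum_nonneg fun i _ => (hC i).le
  set E := (∏ i, c i ^ k i) * (1 + C₀) ^ (-s) * ∏ i, v i with hE
  have hE0 : 0 < E := by
    have h1 : 0 < ∏ i, c i ^ k i := Finset.prod_pos fun i _ => pow_pos (hc i) _
    have h2 : 0 < ∏ i, v i := Finset.prod_pos fun i _ => hv i
    positivity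
  -- Each box contributes at least `E * X ^ (K - s + m)`, with a nonnegative exponent by `hK`.
  -- Integrability would force these contributions to tend to zero.
  have hlow : ∀ n, E ≤ ∫ y in D n, ‖(∏ i, y i ^ k i) * (1 + ‖y‖) ^ (-s)‖ := fun n => by
    set X : ℝ := 2 ^ (n + M) with hX
    have hX1 : 1 ≤ X := one_le_pow₀ one_le_two
    have hX0 : 0 < X := one_pos.trans_le hX1
    have hσ : ∀ i, 0 < (if i ∈ F then 1 else X) := fun i => by split_ifs <;> positivity
    have hvol : volume (D n) = ENNReal.ofReal ((∏ i, v i) * X ^ Fᶜ.card) := by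
      have e : (∏ i, v i) * X ^ Fᶜ.card = ∏ i, (v i * if i ∈ F then 1 else X) := by
        rw [Finset.prod_mul_distrib]
        congr 1
        simpa using (prod_ite_one_pow F X fun _ => 1).symm
      rw [hD, volume_pi_pi, e, ENNReal.ofReal_prod_of_nonneg fun i _ =>
        (mul_pos (hv i) (hσ i)).le]
      exact Finset.prod_congr rfl fun i _ => (h i _ (hM i n)).2.1
    have hv0 : 0 < ∏ i, v i := Finset.prod_pos fun i _ => hv i
    have hreal : volume.real (D n) = (∏ i, v i) * X ^ Fᶜ.card := by
      rw [Measure.real, hvol, ENNReal.toReal_ofReal (by positivity)]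
    have hpt : ∀ y ∈ D n, ((∏ i, c i ^ k i) * X ^ K) * ((1 + C₀) * X) ^ (-s) ≤
        ‖(∏ i, y i ^ k i) * (1 + ‖y‖) ^ (-s)‖ := fun y hy => by
      have hyi := fun i => ((h i _ (hM i n)).2.2 (y i) (hy i trivial)).2.1
      rw [norm_mul, norm_prod, Real.norm_of_nonneg (by positivity : 0 ≤ (1 + ‖y‖) ^ (-s))]
      have hy1 : 1 + ‖y‖ ≤ (1 + C₀) * X := by
        have : ‖y‖ ≤ C₀ * X := by
          refine (pi_norm_le_iff_of_nonneg (by positivity)).2 fun i => (hyi i).2.trans ?_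
          have h1 : C i ≤ C₀ := Finset.single_le_sum (fun i _ => (hC i).le) (Finset.mem_univ i)
          have h2 : (if i ∈ F then 1 else X) ≤ X := by split_ifs <;> simp [hX1]
          exact mul_le_mul h1 h2 (hσ i).le hC₀
        linarith
      refine mul_le_mul ?_ ?_ (by positivity) (Finset.prod_nonneg fun i _ => norm_nonneg _)
      · rw [hKdef, ← prod_ite_one_pow F X k, ← Finset.prod_mul_distrib]
        refine Finset.prod_le_prod (fun i _ => mul_nonneg (pow_nonneg (hc i).le _)
          (pow_nonneg (hσ i).le _)) fun i _ => ?_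
        rw [← mul_pow, norm_pow]
        exact pow_le_pow_left₀ (mul_pos (hc i) (hσ i)).le (hyi i).1 _
      · exact Real.rpow_le_rpow_of_nonpos (by positivity) hy1
          (by have : (0 : ℝ) ≤ Fᶜ.card := Nat.cast_nonneg _
              linarith)
    refine le_trans ?_ (setIntegral_ge_of_const_le_real (hDm n) (by simp [hvol]) hpt
      (hint'.mono_set (hDsub n)))
    rw [hreal, Real.mul_rpow (by positivity) hX0.le]
    have hone : 1 ≤ X ^ K * X ^ (-s) * X ^ Fᶜ.card := by
      rw [← Real.rpow_natCast, ← Real.rpow_natCast, ← Real.rpow_add hX0, ← Real.rpow_add hX0]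
      exact Real.one_le_rpow hX1 (by linarith)
    calc E = E * 1 := (mul_one _).symm
      _ ≤ E * (X ^ K * X ^ (-s) * X ^ Fᶜ.card) := by gcongr
      _ = _ := by rw [hE]; ring
  exact hE0.not_ge (ge_of_tendsto' hsum hlow)

/-- The unbounded part of the monomial is at most `(1 + ‖y‖) ^ K`, leaving decay of order `u = s - K
> m`. Sharing `u` equally among the `m` unbounded coordinates gives each an integrable factor of
exponent `u / m > 1`. -/
theorem integrableOn_of_sum_add_card_lt {p : ℕ} {a b : Fin p → EReal}
    (k : Fin p → ℕ) {s : ℝ}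
    (hs : ((∑ i ∈ (finiteCoords a b)ᶜ, k i : ℕ) : ℝ) + (finiteCoords a b)ᶜ.card < s) :
    IntegrableOn (fun y : Fin p → ℝ => (∏ i, y i ^ k i) * (1 + ‖y‖) ^ (-s))
      (truncationBox a b) := by
  set F := finiteCoords a b with hF
  set K := ∑ i ∈ Fᶜ, k i with hKdef
  set u := s - K with hu
  have hcard : (Fᶜ.card : ℝ) < u := by linarith
  have hu0 : 0 < u := lt_of_le_of_lt (Nat.cast_nonneg _) hcard
  set α := fun i => (a i).toReal
  set β := fun i => (b i).toReal
  let g : Fin p → ℝ → ℝ := fun i t =>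
    if i ∈ F then (Set.Icc (α i) (β i)).indicator (fun t => |t| ^ k i) t
    else (1 + ‖t‖) ^ (-(u / Fᶜ.card))
  have hg : ∀ i, Integrable (g i) := fun i => by
    by_cases hi : i ∈ F
    · simp only [g, hi, if_true]
      refine (integrable_indicator_iff measurableSet_Icc).2 (ContinuousOn.integrableOn_Icc ?_)
      fun_prop
    · simp only [g, hi, if_false]
      refine integrable_one_add_norm ?_
      have : 0 < Fᶜ.card := Finset.card_pos.2 ⟨i, Finset.mem_compl.2 hi⟩
      rw [Module.finrank_self, Nat.cast_one, one_lt_div (by exact_mod_cast this)]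
      exact hcard
  have hmeas : Measurable fun y : Fin p → ℝ => (∏ i, y i ^ k i) * (1 + ‖y‖) ^ (-s) := by
    fun_prop
  refine (Integrable.fintype_prod hg).integrableOn.mono' hmeas.aestronglyMeasurable
    ((ae_restrict_iff' (measurableSet_truncationBox a b)).2 (.of_forall fun y hy => ?_))
  have hyF : ∀ i ∈ F, y i ∈ Set.Icc (α i) (β i) := fun i hi => by
    obtain ⟨⟨h1, h2⟩, h3, h4⟩ := mem_finiteCoords.1 hi
    have := hy i
    rw [← EReal.coe_toReal h2 h1, ← EReal.coe_toReal h4 h3] at this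
    exact_mod_cast this
  have hn : (0 : ℝ) < 1 + ‖y‖ := by positivity
  have hyn : ∀ i, 1 + ‖y i‖ ≤ 1 + ‖y‖ := fun i => by
    gcongr
    exact norm_le_pi_norm y i
  have h1 : ∏ i ∈ Fᶜ, ‖y i ^ k i‖ ≤ (1 + ‖y‖) ^ K := by
    rw [hKdef, ← Finset.prod_pow_eq_pow_sum]
    refine Finset.prod_le_prod (fun i _ => norm_nonneg _) fun i _ => ?_
    rw [norm_pow]
    exact pow_le_pow_left₀ (norm_nonneg _) (by linarith [hyn i]) _
  have h2 : (1 + ‖y‖) ^ (-u) ≤ ∏ i ∈ Fᶜ, (1 + ‖y i‖) ^ (-(u / Fᶜ.card)) := by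
    calc (1 + ‖y‖) ^ (-u) ≤ ∏ i ∈ Fᶜ, (1 + ‖y‖) ^ (-(u / Fᶜ.card)) := by
          rw [Finset.prod_const, ← Real.rpow_natCast, ← Real.rpow_mul hn.le]
          refine Real.rpow_le_rpow_of_exponent_le (by linarith [norm_nonneg y]) ?_
          rw [neg_mul, neg_le_neg_iff]
          -- With no unbounded coordinate the quotient is `0` by convention, and `0 ≤ u` suffices.
          rcases eq_or_ne (Fᶜ.card : ℝ) 0 with h0 | h0
          · simp [h0, hu0.le]
          · rw [div_mul_cancel₀ _ h0]
      _ ≤ _ := Finset.prod_le_prod (fun i _ => by positivity) fun i _ =>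
          Real.rpow_le_rpow_of_nonpos (by positivity) (hyn i)
            (neg_nonpos.2 (by positivity))
  have h3 : ∏ i, g i (y i) = (∏ i ∈ F, ‖y i ^ k i‖) *
      ∏ i ∈ Fᶜ, (1 + ‖y i‖) ^ (-(u / Fᶜ.card)) := by
    rw [← Finset.prod_mul_prod_compl F]
    congr 1
    · exact Finset.prod_congr rfl fun i hi => by simp [g, hi, hyF i hi]
    · exact Finset.prod_congr rfl fun i hi => by simp [g, Finset.mem_compl.1 hi]
  rw [h3, norm_mul, norm_prod, Real.norm_of_nonneg (by positivity : 0 ≤ (1 + ‖y‖) ^ (-s)),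
    ← Finset.prod_mul_prod_compl F, mul_assoc]
  refine mul_le_mul_of_nonneg_left ?_ (Finset.prod_nonneg fun i _ => norm_nonneg _)
  refine le_trans ?_ h2
  calc _ ≤ (1 + ‖y‖) ^ K * (1 + ‖y‖) ^ (-s) := by gcongr
    _ = (1 + ‖y‖) ^ (-u) := by
      rw [← Real.rpow_natCast, ← Real.rpow_add hn]
      congr 1
      rw [hu]
      ring

/-! ### The moment criterion -/

theorem proposition2 {p q : ℕ}
    (mu : Fin p → ℝ) (Sig : Matrix (Fin p) (Fin p) ℝ) (hSig : Sig.PosDef)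
    (Lam : Matrix (Fin p) (Fin q) ℝ) (tau : Fin q → ℝ) (nu : ℝ) (hnu : 0 < nu)
    (Psi : Matrix (Fin q) (Fin q) ℝ) (hPsi : Psi.PosDef) (hPsi_diag : ∀ j, Psi j j = 1)
    (a b : Fin p → EReal) (hab : ∀ i, a i < b i)
    {Ω : Type*} [MeasurableSpace Ω] (P : Measure Ω) [IsProbabilityMeasure P]
    (Y : Ω → Fin p → ℝ) (hY : HasLaw Y (sutLaw mu Sig Lam tau nu Psi) P)
    (k : Fin p → ℕ) :
    Integrable (fun ω => ∏ i, Y ω i ^ k i) (P[|Y ⁻¹' truncationBox a b]) ↔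
      ((∑ i ∈ (finiteCoords a b)ᶜ, k i : ℕ) : ℝ) < nu + (finiteCoords a b).card := by
  obtain ⟨c, C, hc, hC, h⟩ := sutPdf_two_sided mu hSig Lam tau hnu hPsi
  set B := truncationBox a b with hB
  have hBm : MeasurableSet B := measurableSet_truncationBox a b
  have hmom : Measurable fun y : Fin p → ℝ => ∏ i, y i ^ k i := by fun_prop
  have hf := measurable_sutPdf mu Sig Lam tau nu Psi
  have hw : ∀ y : Fin p → ℝ, 0 < (1 + ‖y‖) ^ (-(nu + p)) := fun y => by positivity
  have hf0 : ∀ y, 0 < sutPdf mu Sig Lam tau nu Psi y := fun y =>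
    (mul_pos hc (hw y)).trans_le (h y).1
  -- The density is positive everywhere and the box has positive volume, so conditioning only
  -- rescales by a finite nonzero constant.
  have hPB : P (Y ⁻¹' B) ≠ 0 := by
    rw [← Measure.map_apply_of_aemeasurable hY.aemeasurable hBm, hY.map_eq]
    have hac : volume ≪ sutLaw mu Sig Lam tau nu Psi :=
      withDensity_absolutelyContinuous' hf.ennreal_ofReal.aemeasurable
        (.of_forall fun y => (ENNReal.ofReal_pos.2 (hf0 y)).ne')
    exact fun h0 => (volume_truncationBox_pos hab).ne' (hac h0)
  have hcond : Integrable (fun ω => ∏ i, Y ω i ^ k i) (P[|Y ⁻¹' B]) ↔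
      IntegrableOn (fun y => sutPdf mu Sig Lam tau nu Psi y * ∏ i, y i ^ k i) B := by
    rw [ProbabilityTheory.cond, integrable_smul_measure (ENNReal.inv_ne_zero.2 (measure_ne_top _ _))
      (ENNReal.inv_ne_top.2 hPB)]
    change Integrable ((fun y : Fin p → ℝ => ∏ i, y i ^ k i) ∘ Y) _ ↔ _
    rw [← integrable_map_measure hmom.aestronglyMeasurable hY.aemeasurable.restrict,
      ← Measure.restrict_map_of_aemeasurable hY.aemeasurable hBm, hY.map_eq, sutLaw,
      restrict_withDensity hBm, integrable_withDensity_iff_integrable_smul' hf.ennreal_ofReal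
        (.of_forall fun y => ENNReal.ofReal_lt_top)]
    simp only [ENNReal.toReal_ofReal (hf0 _).le, smul_eq_mul]
    rfl
  have hcomp : IntegrableOn (fun y => sutPdf mu Sig Lam tau nu Psi y * ∏ i, y i ^ k i) B ↔
      IntegrableOn (fun y : Fin p → ℝ => (∏ i, y i ^ k i) * (1 + ‖y‖) ^ (-(nu + p))) B := by
    constructor
    · intro hi
      refine (hi.norm.const_mul c⁻¹).mono' (by fun_prop) (.of_forall fun y => ?_)
      rw [norm_mul, norm_mul, Real.norm_of_nonneg (hw y).le, Real.norm_of_nonneg (hf0 y).le,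
        ← mul_assoc, mul_comm]
      gcongr
      rw [le_inv_mul_iff₀ hc]
      exact (h y).1
    · intro hi
      refine (hi.norm.const_mul C).mono' (by fun_prop) (.of_forall fun y => ?_)
      rw [norm_mul, norm_mul, Real.norm_of_nonneg (hw y).le, Real.norm_of_nonneg (hf0 y).le,
        mul_left_comm, mul_comm]
      gcongr
      exact (h y).2
  -- Turns `K + m < ν + p` into `K < ν + p₁`.
  have hcard : ((finiteCoords a b).card : ℝ) + (finiteCoords a b)ᶜ.card = p := by
    exact_mod_cast (Finset.card_add_card_compl (finiteCoords a b)).trans (Fintype.card_fin p)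
  have hF0 : (0 : ℝ) ≤ (finiteCoords a b).card := Nat.cast_nonneg _
  rw [hcond, hcomp]
  constructor
  · intro hi
    have := sum_add_card_lt_of_integrableOn hab k (by linarith) hi
    linarith
  · intro hlt
    exact integrableOn_of_sum_add_card_lt k (by linarith)
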